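/- \textbf{Definitions.} For a centerless group $G$, identify $G$ with the group $\mathrm{Inn}(G)\le \mathrm{Aut}(G)$ of its inner automorphisms; $\mathrm{Aut}(G)$ is again centerless. The automorphism tower $\langle G^\alpha : \alpha\in\mathrm{Ord}\rangle$ of $G$ is defined by $G^0=G$, $G^{\alpha+1}=\mathrm{Aut}(G^\alpha)$, and $G^\delta=\bigcup_{\alpha<\delta}G^\alpha$ for limit $\delta$. Its height is $\tau_G=\min\{\alpha : G^{\alpha+1}=G^\alpha\}$. Let $M$ be a first-order structure, and let $\varphi(x,X)$ be a first-order formula in the language of $M$, possibly with parameters from $M$, where $x$ is a single individual variable and $X$ is a monadic (unary predicate) variable that is not quantified in $\varphi$ (no positivity in $X$ is required). Put $X^\varphi_0=\emptyset$, $X^\varphi_{\alpha+1}=X^\varphi_\alpha\cup\{x\in M : M\models\varphi(x,X^\varphi_\alpha)\}$, and $X^\varphi_\delta=\bigcup_{\beta<\delta}X^\varphi_\beta$ for limit $\delta$. Let $\delta_\varphi=\min\{\alpha : X^\varphi_\alpha=X^\varphi_{\alpha+1}\}$. The inductive ordinal $\delta(M)$ of $M$ is the first ordinal $\delta$ such that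 $\delta_\varphi<\delta$ for every such formula $\varphi$. \textbf{Theorem.} Let $G$ be a centerless group whose set of elements is a subset of $\omega$. Let $\mathfrak A$ be the structure with universe $\omega\cup\mathcal P(\omega)$ (numbers and sets of numbers being regarded as two disjoint kinds of elements), equipped with the arithmetic operations of $\mathbb N$ on $\omega$, the membership relation between numbers and sets of numbers, and the product of $G$. Then the automorphism tower of $G$ stops (there is an ordinal $\alpha$ with $G^{\alpha+1}=G^\alpha$), and its height satisfies $$\tau_G<\delta(\mathfrak A).$$ -/

import Mathlib

universe u v w

/-! ### The automorphism tower of a group -/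

section Tower

open CategoryTheory CategoryTheory.Limits

theorem GrpCat.hasColimitsOfShape_of_linearOrder (J : Type u) [LinearOrder J] [Nonempty J] :
    HasColimitsOfShape J GrpCat.{u} where
  has_colimit F :=
    ⟨⟨⟨GrpCat.FilteredColimits.colimitCocone.{u, u} F,
      GrpCat.FilteredColimits.colimitCoconeIsColimit.{u, u} F⟩⟩⟩

instance GrpCat.hasIterationOfShape (J : Type u) [LinearOrder J] [Nonempty J] :
    HasIterationOfShape J GrpCat.{u} where
  hasColimitsOfShape_of_isSuccLimit j hj := by
    have := hj.nonempty_Iio.to_subtype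
    exact GrpCat.hasColimitsOfShape_of_linearOrder _
  hasColimitsOfShape := GrpCat.hasColimitsOfShape_of_linearOrder J

/-- One step of the automorphism tower: a group `H` is mapped to `Aut H` by sending an element
to the inner automorphism it induces. (`ULift` only adjusts the universe level, so that the
class of all ordinals can serve as the index set.) -/
def autSuccStruct (G : Type u) [Group G] : SmallObject.SuccStruct GrpCat.{u + 1} where
  X₀ := GrpCat.of (ULift.{u + 1} G)
  succ H := GrpCat.of (MulAut H)
  toSucc H := GrpCat.ofHom (MulAut.conj : H →* MulAut H)

/-- The automorphism tower `G^α`: `G^0 = G`, `G^(α+1) = Aut (G^α)` with the map `G^α → G^(α+1)`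
given by inner automorphisms, and `G^δ` is the direct limit of the `G^α`, `α < δ`, for limit `δ`.
If `G` is centerless, all the maps `G^α → G^β` are injective, and `G^δ` is the union. -/
noncomputable def autTower (G : Type u) [Group G] : Ordinal.{u} ⥤ GrpCat.{u + 1} :=
  (autSuccStruct G).iterationFunctor Ordinal.{u}

/-- `G^(α+1) = G^α`, i.e. the canonical map `G^α → G^(α+1)` is bijective. -/
def AutTowerStopsAt (G : Type u) [Group G] (α : Ordinal.{u}) : Prop :=
  Function.Bijective ((autTower G).map (homOfLE (Order.le_succ α)))

/-- The height `τ_G` of the automorphism tower: the least `α` such that `G^(α+1) = G^α`. -/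
noncomputable def autTowerHeight (G : Type u) [Group G] : Ordinal.{u} :=
  sInf {α | AutTowerStopsAt G α}

end Tower

/-! ### The inductive ordinal of a first-order structure -/

section Inductive

/-- The single symbol of the vocabulary `monadicLang`: a unary predicate. -/
inductive MonadicRel : ℕ → Type
  | X : MonadicRel 1

/-- The vocabulary consisting of one unary predicate symbol, the monadic variable `X`. -/
abbrev monadicLang : FirstOrder.Language.{0, 0} := ⟨fun _ => Empty, MonadicRel⟩

/-- Interpretation of the monadic variable as a given subset of `M`. -/
@[reducible]
def monadicStructure {M : Type w} (A : Set M) : monadicLang.Structure M where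
  funMap f := Empty.elim f
  RelMap
    | .X, a => a 0 ∈ A

variable (L : FirstOrder.Language.{u, v}) (M : Type w) [L.Structure M]

/-- First-order formulas `φ(x, X)` in the vocabulary `L`, with one free individual variable `x`
(the variable `Sum.inr ()`), a monadic variable `X` which is not quantified, and
members of `M` as parameters (the variables `Sum.inl m`). -/
abbrev InductionFormula : Type (max u v w) :=
  (L.sum monadicLang).Formula (M ⊕ Unit)

variable {L M}

/-- `M ⊨ φ(x, A)`, where each parameter `m : M` denotes itself. -/
def InductionFormula.Holds (φ : InductionFormula L M) (x : M) (A : Set M) : Prop :=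
  letI : monadicLang.Structure M := monadicStructure A
  φ.Realize (Sum.elim id fun _ => x)

/-- The stages `X_α^φ` of the induction given by `φ`. -/
noncomputable def InductionFormula.stage (φ : InductionFormula L M) (α : Ordinal.{w}) : Set M :=
  Ordinal.limitRecOn α ∅
    (fun _ A => A ∪ {x | φ.Holds x A})
    (fun δ _ A => {x | ∃ (β : Ordinal.{w}) (hβ : β < δ), x ∈ A β hβ})

/-- `δ_φ`, the least `α` such that `X_α^φ = X_(α+1)^φ`. -/
noncomputable def InductionFormula.closureOrdinal (φ : InductionFormula L M) : Ordinal.{w} :=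
  sInf {α | φ.stage α = φ.stage (α + 1)}

variable (L M)

/-- The inductive ordinal `δ(M)`: the first ordinal which is larger than all `δ_φ`. -/
noncomputable def inductiveOrdinal : Ordinal.{w} :=
  sInf {δ | ∀ φ : InductionFormula L M, φ.closureOrdinal < δ}

end Inductive

/-! ### Second order arithmetic together with a group on a set of natural numbers -/

section Arithmetic

/-- Relation symbols: the constants `0` and `1` and the operations `+` and `·` of `ℕ` (as graphs),
membership, and the product of the group (as a graph). -/
inductive SetArithRel : ℕ → Type
  | zero : SetArithRel 1
  | one : SetArithRel 1
  | add : SetArithRel 3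
  | mul : SetArithRel 3
  | mem : SetArithRel 2
  | prod : SetArithRel 3

/-- The vocabulary of arithmetic, membership and a group product. -/
abbrev setArithLang : FirstOrder.Language.{0, 0} := ⟨fun _ => Empty, SetArithRel⟩

/-- The universe `ω ∪ 𝒫(ω)`, with numbers and sets of numbers as two separate kinds of elements.
The subset `S` of `ω` carries the group of the structure defined below. -/
inductive SetArith (S : Set ℕ) : Type
  | num (n : ℕ) : SetArith S
  | set (A : Set ℕ) : SetArith S

instance SetArith.instStructure (S : Set ℕ) [Group S] : setArithLang.Structure (SetArith S) where
  funMap f := Empty.elim f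
  RelMap
    | .zero, a => a 0 = .num 0
    | .one, a => a 0 = .num 1
    | .add, a => ∃ m n : ℕ, a 0 = .num m ∧ a 1 = .num n ∧ a 2 = .num (m + n)
    | .mul, a => ∃ m n : ℕ, a 0 = .num m ∧ a 1 = .num n ∧ a 2 = .num (m * n)
    | .mem, a => ∃ (n : ℕ) (A : Set ℕ), a 0 = .num n ∧ a 1 = .set A ∧ n ∈ A
    | .prod, a => ∃ g h : S, a 0 = .num g ∧ a 1 = .num h ∧ a 2 = .num (g * h : S)

end Arithmetic

/-! The point is rigidity over `G`: an element of `G^γ` is determined by its quantifier-free type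
over `G`, that is, by the set of words with coefficients in `G` that vanish at it
(`hom_ext_of_ker_le`, `rigid_base`). If `z` lies in `G^(α+1)`, conjugation by `z` sends `G` into
`G^α`, so an induction along the tower applies, and what remains undetermined centralizes `G`. The
centralizer of `G` is trivial at every level (`trans_injective_and_centralizer`).

For countable `G` the words are countable, so a type is a set of numbers up to coding. Let `types G
α` be the set of types of pairs from `G^α`. Pairs suffice to read off the product, so `G^α` is
interpretable in `types G α`. An automorphism is determined by its countably many values on `G`,
hence is coded by one set of words, and so is a sequence of automorphisms indexed by words. Thus
`types G (α+1)` is obtained from `types G α` by one operator `autTypes` (`types_succ`), which is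
first-order definable over second order arithmetic.

Iterating this operator gives an induction whose stages are the sets `types G α` for `α ≠ 0`
(`exists_stage_eq_types`). These sets increase, so they stabilize. When two consecutive ones agree,
rigidity makes the tower stop (`stopsAt_of_types_eq`), so the height is at most the closure ordinal
of that induction. -/

/-! ### The groups of the automorphism tower -/

section TowerGroups

open CategoryTheory CategoryTheory.Limits

namespace autTower

variable (G : Type u) [Group G]

/-- The transition maps of the automorphism tower. -/
noncomputable def trans {α β : Ordinal.{u}} (h : α ≤ β) :
    (autTower G).obj α →* (autTower G).obj β :=
  ((autTower G).map (homOfLE h)).hom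

theorem trans_refl (α : Ordinal.{u}) (x : (autTower G).obj α) : trans G le_rfl x = x := by
  simp [trans]

theorem trans_trans {α β γ : Ordinal.{u}} (h : α ≤ β) (h' : β ≤ γ) (x : (autTower G).obj α) :
    trans G h' (trans G h x) = trans G (h.trans h') x := by
  have : (autTower G).map (homOfLE (h.trans h')) =
      (autTower G).map (homOfLE h) ≫ (autTower G).map (homOfLE h') := by
    rw [← Functor.map_comp]; rfl
  simp [trans, this]

/-- The bottom of the automorphism tower is `G`. -/
noncomputable def botEquiv : G ≃* (autTower G).obj 0 :=
  MulEquiv.ulift.symm.trans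
    ((autSuccStruct G).iterationFunctorObjBotIso Ordinal.{u}).symm.groupIsoToMulEquiv

/-- The embedding of `G` into a group of its automorphism tower. -/
noncomputable def base (α : Ordinal.{u}) : G →* (autTower G).obj α :=
  (trans G (zero_le : 0 ≤ α)).comp (botEquiv G).toMonoidHom

theorem trans_base {α β : Ordinal.{u}} (h : α ≤ β) (g : G) :
    trans G h (base G α g) = base G β g :=
  trans_trans G zero_le h _

/-- The identification of `G^(α+1)` with the automorphism group of `G^α`. -/
noncomputable def succEquiv (α : Ordinal.{u}) :
    (autTower G).obj (Order.succ α) ≃* MulAut ((autTower G).obj α) :=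
  ((autSuccStruct G).iterationFunctorObjSuccIso α (not_isMax α)).groupIsoToMulEquiv

theorem succEquiv_trans (α : Ordinal.{u}) (x : (autTower G).obj α) :
    succEquiv G α (trans G (Order.le_succ α) x) = MulAut.conj x := by
  have h := (autSuccStruct G).iterationFunctor_map_succ α (not_isMax α)
  have h2 : trans G (Order.le_succ α) x = (succEquiv G α).symm (MulAut.conj x) :=
    congrArg (fun f => f.hom x) h
  rw [h2, MulEquiv.apply_symm_apply]

theorem conj_trans (α : Ordinal.{u}) (z : (autTower G).obj (Order.succ α))
    (x : (autTower G).obj α) :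
    z * trans G (Order.le_succ α) x * z⁻¹ = trans G (Order.le_succ α) (succEquiv G α z x) := by
  apply (succEquiv G α).injective
  rw [succEquiv_trans, map_mul, map_mul, succEquiv_trans, map_inv]
  ext y
  simp [MulAut.conj_apply]

/-- At limits the tower is continuous. -/
noncomputable def isColimitOfIsSuccLimit {δ : Ordinal.{u}} (hδ : Order.IsSuccLimit δ) :
    IsColimit ((Set.principalSegIio δ).cocone (autTower G)) :=
  (((autSuccStruct G).iterationFunctor Ordinal.{u}).isColimitOfIsWellOrderContinuous δ hδ)

theorem exists_trans_eq_of_isSuccLimit {δ : Ordinal.{u}} (hδ : Order.IsSuccLimit δ)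
    (x : (autTower G).obj δ) : ∃ β, ∃ h : β < δ, ∃ y, trans G h.le y = x := by
  have := hδ.nonempty_Iio.to_subtype
  have := isColimitOfPreserves (forget GrpCat.{u + 1}) (isColimitOfIsSuccLimit G hδ)
  obtain ⟨⟨β, hβ⟩, y, hy⟩ := Types.jointly_surjective _ this x
  exact ⟨β, hβ, y, hy⟩

theorem exists_trans_eq_of_trans_eq {δ : Ordinal.{u}} (hδ : Order.IsSuccLimit δ) {β : Ordinal.{u}}
    (hβ : β < δ) {x y : (autTower G).obj β} (h : trans G hβ.le x = trans G hβ.le y) :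
    ∃ γ, ∃ h : β ≤ γ, γ < δ ∧ trans G h x = trans G h y := by
  have := hδ.nonempty_Iio.to_subtype
  have hc := isColimitOfPreserves (forget GrpCat.{u + 1}) (isColimitOfIsSuccLimit G hδ)
  obtain ⟨⟨γ, hγ⟩, f, hf⟩ :=
    (Types.FilteredColimit.isColimit_eq_iff' hc (i := ⟨β, hβ⟩) x y).1 h
  exact ⟨γ, leOfHom f, hγ, hf⟩

/-! ### Rigidity of the tower over its bottom -/

variable {G}

/-- If `G` has trivial centralizer in `G^γ`, a homomorphism into `G^γ` which extends the identity
of `G` is determined by its kernel. -/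
theorem hom_ext_of_ker_le {γ : Ordinal.{u}}
    (hγ : ∀ z : (autTower G).obj γ, (∀ g, z * base G γ g = base G γ g * z) → z = 1)
    {K : Type*} [Group K] {ρ ρ' : K →* (autTower G).obj γ} (hker : ∀ w, ρ w = 1 → ρ' w = 1)
    {j : G → K} (hj : ∀ g, ρ (j g) = base G γ g) (hj' : ∀ g, ρ' (j g) = base G γ g) : ρ = ρ' := by
  have eq_of_eq : ∀ v w, ρ v = ρ w → ρ' v = ρ' w := fun v w h => by
    rw [← mul_inv_eq_one, ← map_inv, ← map_mul]
    exact hker _ (by rw [map_mul, map_inv, h, mul_inv_cancel])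
  -- The induction is on the level at which the value `ρ w` first needs to be placed, with `w`
  -- varying.
  have key : ∀ (α : Ordinal.{u}) (h : α ≤ γ) (w : K) (x : (autTower G).obj α),
      trans G h x = ρ w → ρ' w = ρ w := by
    intro α
    induction α using Ordinal.limitRecOn with
    | zero =>
      intro h w x hx
      obtain ⟨g, rfl⟩ := (botEquiv G).surjective x
      have hx : base G γ g = ρ w := hx
      rw [← hx, ← hj' g]
      exact eq_of_eq _ _ (by rw [hj, hx])
    | add_one α ih =>
      rw [← Order.succ_eq_add_one]
      intro h w x hx
      -- An element of `G^(α+1)` conjugates `G` into `G^α`, where the induction hypothesis holds.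
      -- Hence `ρ w` and `ρ' w` induce the same conjugation on `G`, and `(ρ' w)⁻¹ * ρ w` centralizes
      -- `G`.
      have hconj : ∀ g, ρ' (w * j g * w⁻¹) = ρ (w * j g * w⁻¹) := fun g => by
        refine ih ((Order.le_succ α).trans h) _ (succEquiv G α x (base G α g)) ?_
        rw [← trans_trans G (Order.le_succ α) h, ← conj_trans, map_mul, map_mul, map_inv,
          trans_base, trans_base, map_mul, map_mul, map_inv, hj]
        erw [hx]
      rw [← inv_mul_eq_one]
      refine hγ _ fun g => ?_
      have := hconj g
      simp only [map_mul, map_inv, hj, hj'] at this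
      calc (ρ' w)⁻¹ * ρ w * base G γ g
          = (ρ' w)⁻¹ * (ρ w * base G γ g * (ρ w)⁻¹) * ρ w := by group
        _ = base G γ g * ((ρ' w)⁻¹ * ρ w) := by rw [← this]; group
    | limit δ hδ ih =>
      intro h w x hx
      obtain ⟨β, hβ, y, rfl⟩ := exists_trans_eq_of_isSuccLimit G hδ x
      exact ih β hβ (hβ.le.trans h) w y (by rw [← hx, trans_trans])
  ext w
  exact (key γ le_rfl w (ρ w) (trans_refl ..)).symm

/-- The two claims need each other: the kernel of `G^γ → G^(γ+1)` is the center of `G^γ`, which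
centralizes `G`; and injectivity turns an element of `G^(γ+1)` commuting with `G` into an
automorphism of `G^γ` fixing `G` pointwise. -/
theorem trans_injective_and_centralizer (hG : Subgroup.center G = ⊥) (γ : Ordinal.{u}) :
    (∀ β, ∀ h : β ≤ γ, Function.Injective (trans G h)) ∧
      ∀ z : (autTower G).obj γ, (∀ g, z * base G γ g = base G γ g * z) → z = 1 := by
  induction γ using Ordinal.limitRecOn with
  | zero =>
    refine ⟨fun β h => ?_, fun z hz => ?_⟩
    · obtain rfl : β = 0 := le_antisymm h zero_le
      intro x y hxy
      rwa [trans_refl, trans_refl] at hxy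
    · obtain ⟨g, rfl⟩ := (botEquiv G).surjective z
      have hb : ∀ k, base G 0 k = botEquiv G k := fun k => trans_refl ..
      have : g ∈ Subgroup.center G := Subgroup.mem_center_iff.2 fun k =>
        (botEquiv G).injective <| by rw [map_mul, map_mul, ← hb k, hz k]
      rw [hG, Subgroup.mem_bot] at this
      rw [this, map_one]
  | add_one γ ih =>
    rw [← Order.succ_eq_add_one]
    have hinj : Function.Injective (trans G (Order.le_succ γ)) := by
      rw [injective_iff_map_eq_one]
      intro x hx
      refine ih.2 x fun g => ?_
      have h1 := succEquiv_trans G γ x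
      rw [hx, map_one] at h1
      have h2 := congrArg (fun f => f (base G γ g)) h1
      simp only [MulAut.one_apply, MulAut.conj_apply] at h2
      exact (eq_mul_inv_iff_mul_eq.1 h2).symm
    refine ⟨fun β h => ?_, fun z hz => ?_⟩
    · rcases h.lt_or_eq with h' | rfl
      · have hβ : β ≤ γ := Order.lt_succ_iff.1 h'
        intro x y hxy
        rw [← trans_trans G hβ (Order.le_succ γ), ← trans_trans G hβ (Order.le_succ γ)] at hxy
        exact ih.1 β hβ (hinj hxy)
      · intro x y hxy
        rwa [trans_refl, trans_refl] at hxy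
    · have hfix : ∀ g, succEquiv G γ z (base G γ g) = base G γ g := fun g => hinj <| by
        rw [← conj_trans, trans_base]
        exact mul_inv_eq_iff_eq_mul.2 (hz g)
      -- The identity has trivial kernel, so rigidity forces the automorphism fixing `G` to be the
      -- identity.
      have := hom_ext_of_ker_le ih.2 (ρ := MonoidHom.id _) (ρ' := (succEquiv G γ z).toMonoidHom)
        (fun w hw => by rw [show w = 1 from hw]; exact map_one _) (j := base G γ)
        (fun _ => rfl) hfix
      apply (succEquiv G γ).injective
      rw [map_one]
      ext x
      exact (DFunLike.congr_fun this x).symm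
  | limit δ hδ ih =>
    have hinj : ∀ β, ∀ h : β ≤ δ, Function.Injective (trans G h) := by
      intro β h x y hxy
      rcases h.lt_or_eq with h' | rfl
      · obtain ⟨γ, hβγ, hγ, e⟩ := exists_trans_eq_of_trans_eq G hδ h' hxy
        exact (ih γ hγ).1 β hβγ e
      · rwa [trans_refl, trans_refl] at hxy
    refine ⟨hinj, fun z hz => ?_⟩
    obtain ⟨β, hβ, y, rfl⟩ := exists_trans_eq_of_isSuccLimit G hδ z
    rw [(ih β hβ).2 y fun g => hinj β hβ.le ?_, map_one]
    rw [map_mul, map_mul, trans_base, hz g]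

theorem trans_injective (hG : Subgroup.center G = ⊥) {β γ : Ordinal.{u}} (h : β ≤ γ) :
    Function.Injective (trans G h) :=
  (trans_injective_and_centralizer hG γ).1 β h

theorem base_injective (hG : Subgroup.center G = ⊥) (γ : Ordinal.{u}) :
    Function.Injective (base G γ) :=
  (trans_injective hG zero_le).comp (botEquiv G).injective

end autTower

end TowerGroups

/-! ### Definability in second order arithmetic with a monadic predicate -/

section Definability

open FirstOrder FirstOrder.Language

/-- Formulas of second order arithmetic with a group and a monadic variable. -/
abbrev SetArithFormula (V : Type) : Type :=
  (setArithLang.sum monadicLang).Formula V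

section Satisfaction

variable {S : Set ℕ} [Group S]

/-- Satisfaction of a formula when the monadic variable denotes `A`. -/
def SetArithFormula.Sat {V : Type} (φ : SetArithFormula V) (A : Set (SetArith S))
    (v : V → SetArith S) : Prop :=
  letI : monadicLang.Structure (SetArith S) := monadicStructure A
  φ.Realize v

namespace SetArithFormula

variable {V V' : Type} {A : Set (SetArith S)} {v : V → SetArith S}

theorem sat_not (φ : SetArithFormula V) : Sat φ.not A v ↔ ¬ Sat φ A v := Iff.rfl

theorem sat_imp (φ ψ : SetArithFormula V) : Sat (φ.imp ψ) A v ↔ (Sat φ A v → Sat ψ A v) := Iff.rfl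

theorem sat_relabel (φ : SetArithFormula V') (f : V' → V) :
    Sat (φ.relabel f) A v ↔ Sat φ A (v ∘ f) :=
  letI : monadicLang.Structure (SetArith S) := monadicStructure A
  Formula.realize_relabel

theorem sat_iAlls (φ : SetArithFormula (V ⊕ Unit)) :
    Sat (φ.iAlls Unit) A v ↔ ∀ x : SetArith S, Sat φ A (Sum.elim v fun _ => x) :=
  letI : monadicLang.Structure (SetArith S) := monadicStructure A
  Formula.realize_iAlls.trans
    ⟨fun h x => h fun _ => x, fun h i => h (i ())⟩

theorem sat_equal (x y : V) : Sat (Term.equal (.var x) (.var y)) A v ↔ v x = v y :=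
  letI : monadicLang.Structure (SetArith S) := monadicStructure A
  Formula.realize_equal

theorem sat_rel {n : ℕ} (R : SetArithRel n) (a : Fin n → V) :
    Sat (Relations.formula (L := setArithLang.sum monadicLang) (Sum.inl R) fun i => Term.var (a i))
      A v ↔ Structure.RelMap (L := setArithLang) R fun i => v (a i) :=
  Iff.rfl

theorem sat_monadic (a : V) :
    Sat (Relations.formula (L := setArithLang.sum monadicLang) (n := 1) (Sum.inr MonadicRel.X)
      fun _ => Term.var a) A v ↔ v a ∈ A :=
  Iff.rfl

end SetArithFormula

end Satisfaction

/-! ### A calculus of definable predicates, functions and families -/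

open SetArithFormula

/-- A type whose elements are represented bijectively by the numbers or by the sets of numbers. -/
class SetArithCoded (S : Set ℕ) (β : Type) where
  code : β → SetArith S
  code_injective : Function.Injective code
  range_code : Set.range code = Set.range SetArith.num ∨ Set.range code = Set.range SetArith.set

open SetArithCoded

instance SetArithCoded.ofDenumerable (S : Set ℕ) (W : Type) [Denumerable W] :
    SetArithCoded S W where
  code w := .num (Encodable.encode w)
  code_injective _ _ h := Encodable.encode_injective (SetArith.num.inj h)
  range_code := .inl <| by
    ext x
    constructor
    · rintro ⟨w, rfl⟩
      exact ⟨_, rfl⟩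
    · rintro ⟨n, rfl⟩
      exact ⟨Denumerable.ofNat W n, by simp⟩

instance SetArithCoded.setOfDenumerable (S : Set ℕ) (W : Type) [Denumerable W] :
    SetArithCoded S (Set W) where
  code p := .set (Encodable.encode '' p)
  code_injective _ _ h := Encodable.encode_injective.image_injective (SetArith.set.inj h)
  range_code := .inr <| by
    ext x
    constructor
    · rintro ⟨w, rfl⟩
      exact ⟨_, rfl⟩
    · rintro ⟨p, rfl⟩
      exact ⟨Denumerable.ofNat W '' p, by simp [Set.image_image]⟩

/-- A context of variables: a type of assignments, each of which determines the value of the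
monadic variable, and the values of individual variables, among which all parameters occur. -/
class SetArithCtx (S : Set ℕ) (Γ : Type) where
  Var : Type
  env : Γ → Var → SetArith S
  fam : Γ → Set (SetArith S)
  param : SetArith S → Var
  env_param : ∀ γ m, env γ (param m) = m

open SetArithCtx

instance SetArithCtx.base (S : Set ℕ) : SetArithCtx S (Set (SetArith S)) where
  Var := SetArith S
  env _ m := m
  fam A := A
  param m := m
  env_param _ _ := rfl

instance SetArithCtx.prod (S : Set ℕ) (Γ β : Type) [SetArithCtx S Γ] [SetArithCoded S β] :
    SetArithCtx S (Γ × β) where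
  Var := Var S Γ ⊕ Unit
  env γ := Sum.elim (env γ.1) fun _ => code γ.2
  fam γ := fam γ.1
  param m := .inl (param m)
  env_param γ m := env_param γ.1 m

/-- Maps of assignments which pull back variables to variables. -/
def SetArithRenaming (S : Set ℕ) {Γ Γ' : Type} [SetArithCtx S Γ] [SetArithCtx S Γ']
    (g : Γ' → Γ) : Prop :=
  (∀ γ, fam (S := S) (g γ) = fam γ) ∧
    ∃ f : Var S Γ → Var S Γ', ∀ γ x, env (g γ) x = env (S := S) γ (f x)

section Renaming

variable {S : Set ℕ} {Γ Γ' β β' : Type} [SetArithCtx S Γ] [SetArithCtx S Γ'] [SetArithCoded S β]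
  [SetArithCoded S β']

namespace SetArithRenaming

theorem fst : SetArithRenaming S (Prod.fst : Γ × β → Γ) :=
  ⟨fun _ => rfl, Sum.inl, fun _ _ => rfl⟩

theorem lift {g : Γ' → Γ} (hg : SetArithRenaming S g) :
    SetArithRenaming S fun q : Γ' × β => (g q.1, q.2) := by
  obtain ⟨h, f, hf⟩ := hg
  refine ⟨fun q => h q.1, Sum.map f id, ?_⟩
  rintro q (x | x)
  · exact hf q.1 x
  · rfl

theorem recode {h : β' → β} (hh : ∀ b, code (S := S) (h b) = code b) :
    SetArithRenaming S fun q : Γ × β' => (q.1, h q.2) := by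
  refine ⟨fun q => rfl, id, ?_⟩
  rintro q (x | x)
  · rfl
  · exact hh q.2

end SetArithRenaming

end Renaming

variable {S : Set ℕ} [Group S]

/-- First-order definability of a predicate on assignments. -/
def SetArithDef (S : Set ℕ) [Group S] {Γ : Type} [SetArithCtx S Γ] (P : Γ → Prop) : Prop :=
  ∃ φ : SetArithFormula (Var S Γ), ∀ γ, Sat φ (fam γ) (env (S := S) γ) ↔ P γ

/-- Definability of a function on assignments. -/
def SetArithTerm (S : Set ℕ) [Group S] {Γ β : Type} [SetArithCtx S Γ] [SetArithCoded S β]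
    (f : Γ → β) : Prop :=
  SetArithDef S fun q : Γ × β => q.2 = f q.1

/-- Definability of a family of sets. -/
def SetArithFam (S : Set ℕ) [Group S] {Γ W : Type} [SetArithCtx S Γ] [Denumerable W]
    (X : Γ → Set (Set W)) : Prop :=
  SetArithDef S fun q : Γ × Set W => q.2 ∈ X q.1

variable {Γ Γ' β β' W : Type} [SetArithCtx S Γ] [SetArithCtx S Γ'] [SetArithCoded S β]
  [SetArithCoded S β'] [Denumerable W]

namespace SetArithDef

variable {P Q : Γ → Prop}

theorem congr (hP : SetArithDef S P) (h : ∀ γ, P γ ↔ Q γ) : SetArithDef S Q := by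
  obtain ⟨φ, hφ⟩ := hP
  exact ⟨φ, fun γ => (hφ γ).trans (h γ)⟩

theorem rename (hP : SetArithDef S P) {g : Γ' → Γ} (hg : SetArithRenaming S g) :
    SetArithDef S fun γ => P (g γ) := by
  obtain ⟨φ, hφ⟩ := hP
  obtain ⟨h, f, hf⟩ := hg
  refine ⟨φ.relabel f, fun γ => ?_⟩
  change _ ↔ P (g γ)
  rw [sat_relabel, ← hφ (g γ), h]
  exact iff_of_eq (congrArg _ (funext fun x => (hf γ x).symm))

theorem not (hP : SetArithDef S P) : SetArithDef S fun γ => ¬ P γ := by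
  obtain ⟨φ, hφ⟩ := hP
  exact ⟨φ.not, fun γ => by rw [sat_not, hφ]⟩

theorem imp (hP : SetArithDef S P) (hQ : SetArithDef S Q) : SetArithDef S fun γ => P γ → Q γ := by
  obtain ⟨φ, hφ⟩ := hP
  obtain ⟨ψ, hψ⟩ := hQ
  exact ⟨φ.imp ψ, fun γ => by rw [sat_imp, hφ, hψ]⟩

theorem and (hP : SetArithDef S P) (hQ : SetArithDef S Q) : SetArithDef S fun γ => P γ ∧ Q γ :=
  (hP.imp hQ.not).not.congr fun γ => by tauto

theorem or (hP : SetArithDef S P) (hQ : SetArithDef S Q) : SetArithDef S fun γ => P γ ∨ Q γ :=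
  (hP.not.imp hQ).congr fun γ => by tauto

theorem iff (hP : SetArithDef S P) (hQ : SetArithDef S Q) : SetArithDef S fun γ => (P γ ↔ Q γ) :=
  ((hP.imp hQ).and (hQ.imp hP)).congr fun γ => by tauto

/-- Numbers are the elements that have a sum with themselves. This separates the two sorts, so that
quantifiers can be relativized. -/
theorem exists_isNum_formula {V : Type} (x : V) : ∃ φ : SetArithFormula V,
    ∀ (A : Set (SetArith S)) v, Sat φ A v ↔ v x ∈ Set.range SetArith.num := by
  refine ⟨((Relations.formula (L := setArithLang.sum monadicLang) (Sum.inl SetArithRel.add)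
    fun i => Term.var ((![.inl x, .inl x, .inr ()] : Fin 3 → V ⊕ Unit) i)).not.iAlls Unit).not,
    fun A v => ?_⟩
  rw [sat_not, sat_iAlls]
  simp only [sat_not, not_forall, not_not]
  constructor
  · rintro ⟨y, m, n, h, -, -⟩
    exact ⟨m, h.symm⟩
  · rintro ⟨m, h⟩
    exact ⟨.num (m + m), m, m, h.symm, h.symm, rfl⟩

theorem exists_mem_range_code_formula (β : Type) [SetArithCoded S β] {V : Type} (x : V) :
    ∃ φ : SetArithFormula V, ∀ (A : Set (SetArith S)) v,
      Sat φ A v ↔ v x ∈ Set.range (code : β → SetArith S) := by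
  obtain ⟨φ, hφ⟩ := exists_isNum_formula (S := S) x
  rcases range_code (S := S) (β := β) with h | h
  · exact ⟨φ, fun A v => by rw [h, hφ]⟩
  · refine ⟨φ.not, fun A v => ?_⟩
    rw [h, sat_not, hφ]
    cases v x <;> simp

theorem all {P : Γ → β → Prop} (hP : SetArithDef S fun q : Γ × β => P q.1 q.2) :
    SetArithDef S fun γ => ∀ b, P γ b := by
  obtain ⟨φ, hφ⟩ := hP
  obtain ⟨ψ, hψ⟩ := exists_mem_range_code_formula (S := S) β (V := Var S Γ ⊕ Unit) (.inr ())
  refine ⟨(ψ.imp φ).iAlls Unit, fun γ => ?_⟩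
  rw [sat_iAlls]
  simp only [sat_imp, hψ]
  constructor
  · exact fun h b => (hφ (γ, b)).1 (h (code b) ⟨b, rfl⟩)
  · rintro h x ⟨b, rfl⟩
    exact (hφ (γ, b)).2 (h b)

theorem ex {P : Γ → β → Prop} (hP : SetArithDef S fun q : Γ × β => P q.1 q.2) :
    SetArithDef S fun γ => ∃ b, P γ b :=
  (all (P := fun γ b => ¬ P γ b) hP.not).not.congr fun γ => by simp

/-- A definable function is eliminated by quantifying over its value, which its graph determines. -/
theorem subst {P : Γ → β → Prop} (hP : SetArithDef S fun q : Γ × β => P q.1 q.2) {f : Γ → β}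
    (hf : SetArithTerm S f) : SetArithDef S fun γ => P γ (f γ) :=
  (ex (P := fun γ b => b = f γ ∧ P γ b) (SetArithDef.and hf hP)).congr fun γ => by simp

end SetArithDef

theorem SetArithDef.rel {n : ℕ} (R : SetArithRel n) (a : Fin n → Var S Γ) :
    SetArithDef S fun γ : Γ =>
      Structure.RelMap (L := setArithLang) R fun i => env (S := S) γ (a i) :=
  ⟨_, fun _ => sat_rel R a⟩

namespace SetArithTerm

theorem weaken {f : Γ → β} (hf : SetArithTerm S f) : SetArithTerm S fun q : Γ × β' => f q.1 :=
  SetArithDef.rename hf SetArithRenaming.fst.lift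

theorem ofVar {f : Γ → β} (x : Var S Γ) (h : ∀ γ, env γ x = code (S := S) (f γ)) :
    SetArithTerm S f := by
  refine ⟨Term.equal (.var (.inr ())) (.var (.inl x)), fun q => ?_⟩
  rw [sat_equal]
  change code q.2 = env q.1 x ↔ _
  rw [h, code_injective.eq_iff]

theorem const (b : β) : SetArithTerm S fun _ : Γ => b :=
  ofVar (param (code b)) fun _ => env_param ..

theorem var : SetArithTerm S fun q : Γ × β => q.2 :=
  ofVar (.inr ()) fun _ => rfl

theorem eq {f g : Γ → β} (hf : SetArithTerm S f) (hg : SetArithTerm S g) :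
    SetArithDef S fun γ => f γ = g γ :=
  SetArithDef.subst (P := fun γ b => b = g γ) hg hf

theorem mem {f : Γ → W} {g : Γ → Set W} (hf : SetArithTerm S f) (hg : SetArithTerm S g) :
    SetArithDef S fun γ => f γ ∈ g γ := by
  have atom : SetArithDef S fun q : (Γ × W) × Set W => q.1.2 ∈ q.2 :=
    (SetArithDef.rel (Γ := (Γ × W) × Set W) SetArithRel.mem
      ![Sum.inl (Sum.inr ()), Sum.inr ()]).congr fun q => by
      constructor
      · rintro ⟨n, A, hn, hA, h⟩
        obtain rfl : Encodable.encode q.1.2 = n := SetArith.num.inj hn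
        obtain rfl : Encodable.encode '' q.2 = A := SetArith.set.inj hA
        exact (Encodable.encode_injective.mem_set_image).1 h
      · exact fun h => ⟨_, _, rfl, rfl, Set.mem_image_of_mem _ h⟩
  exact SetArithDef.subst (P := fun γ b => b ∈ g γ)
    (SetArithDef.subst (P := fun (q : Γ × W) A => q.2 ∈ A) atom hg.weaken) hf

theorem setOf {P : Γ → W → Prop} (hP : SetArithDef S fun q : Γ × W => P q.1 q.2) :
    SetArithTerm S fun γ => {w | P γ w} :=
  (SetArithDef.all (P := fun (q : Γ × Set W) w => w ∈ q.2 ↔ P q.1 w)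
    ((mem var var.weaken).iff (hP.rename SetArithRenaming.fst.lift))).congr fun _ =>
      Set.ext_iff.symm

/-- A member of `W` and its number have the same code in the structure, so only the reading of the
variable changes. -/
theorem encode {f : Γ → W} (hf : SetArithTerm S f) :
    SetArithTerm S fun γ => Encodable.encode (f γ) :=
  (SetArithDef.rename hf (SetArithRenaming.recode (h := Denumerable.ofNat W) fun n => by
    simp [code])).congr fun q => by
      change Denumerable.ofNat W q.2 = f q.1 ↔ q.2 = Encodable.encode (f q.1)
      constructor
      · intro h
        rw [← h, Denumerable.encode_ofNat]
      · intro h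
        rw [h, Denumerable.ofNat_encode]

theorem ofNat {f : Γ → ℕ} (hf : SetArithTerm S f) :
    SetArithTerm S fun γ => Denumerable.ofNat W (f γ) :=
  (SetArithDef.rename hf (SetArithRenaming.recode (h := Encodable.encode (α := W)) fun n => by
    simp [code])).congr fun q => by
      change Encodable.encode q.2 = f q.1 ↔ q.2 = Denumerable.ofNat W (f q.1)
      constructor
      · intro h
        rw [← h, Denumerable.ofNat_encode]
      · intro h
        rw [h, Denumerable.encode_ofNat]

theorem ofGraph {R : SetArithRel 3} {op : ℕ → ℕ → ℕ}
    (hR : ∀ a : Fin 3 → SetArith S, Structure.RelMap (L := setArithLang) R a ↔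
      ∃ m n : ℕ, a 0 = .num m ∧ a 1 = .num n ∧ a 2 = .num (op m n))
    {f g : Γ → ℕ} (hf : SetArithTerm S f) (hg : SetArithTerm S g) :
    SetArithTerm S fun γ => op (f γ) (g γ) := by
  have atom : SetArithDef S fun q : ((Γ × ℕ) × ℕ) × ℕ => q.1.1.2 = op q.1.2 q.2 :=
    (SetArithDef.rel (Γ := ((Γ × ℕ) × ℕ) × ℕ) R
      ![Sum.inl (Sum.inr ()), Sum.inr (), Sum.inl (Sum.inl (Sum.inr ()))]).congr
      fun q => by
        rw [hR]
        constructor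
        · rintro ⟨m, n, hm, hn, h⟩
          obtain rfl : q.1.2 = m := SetArith.num.inj hm
          obtain rfl : q.2 = n := SetArith.num.inj hn
          exact SetArith.num.inj h
        · exact fun h => ⟨_, _, rfl, rfl, congrArg SetArith.num h⟩
  exact SetArithDef.subst (P := fun (q : Γ × ℕ) b => q.2 = op b (g q.1))
    (SetArithDef.subst (P := fun (q : (Γ × ℕ) × ℕ) b => q.1.2 = op q.2 b) atom hg.weaken.weaken)
    hf.weaken

theorem add {f g : Γ → ℕ} (hf : SetArithTerm S f) (hg : SetArithTerm S g) :
    SetArithTerm S fun γ => f γ + g γ :=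
  ofGraph (R := SetArithRel.add) (fun _ => Iff.rfl) hf hg

theorem mul {f g : Γ → ℕ} (hf : SetArithTerm S f) (hg : SetArithTerm S g) :
    SetArithTerm S fun γ => f γ * g γ :=
  ofGraph (R := SetArithRel.mul) (fun _ => Iff.rfl) hf hg

end SetArithTerm

/-! ### Coding pairs and sequences of sets -/

/-- An injective pairing function which is a polynomial in the codes. -/
def codePair {W : Type} [Denumerable W] (a b : W) : W :=
  Denumerable.ofNat W ((Encodable.encode a + Encodable.encode b) *
    (Encodable.encode a + Encodable.encode b) + Encodable.encode a)

/-- With `s = m + n`, the number `s² + m` lies between `s²` and `(s+1)² - 1`, so it determines `s`,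
then `m`. -/
theorem codePair_inj {W : Type} [Denumerable W] {a b a' b' : W} :
    codePair a b = codePair a' b' ↔ a = a' ∧ b = b' := by
  refine ⟨fun h => ?_, fun ⟨h, h'⟩ => by rw [h, h']⟩
  have h := congrArg Encodable.encode h
  simp only [codePair, Denumerable.encode_ofNat] at h
  rw [← Encodable.encode_injective.eq_iff, ← Encodable.encode_injective.eq_iff (a := b)]
  generalize Encodable.encode a = m at *
  generalize Encodable.encode b = n at *
  generalize Encodable.encode a' = m' at *
  generalize Encodable.encode b' = n' at *
  have : m + n = m' + n' := by
    rcases lt_trichotomy (m + n) (m' + n') with hlt | heq | hlt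
    · nlinarith
    · exact heq
    · nlinarith
  rw [this] at h
  omega

/-- The `k`-th member of the sequence of sets coded by `r`. -/
def codeSlice {W : Type} [Denumerable W] (r : Set W) (k : W) : Set W :=
  {v | codePair k v ∈ r}

theorem exists_codeSlice_eq {W : Type} [Denumerable W] (R : W → Set W) :
    ∃ r, ∀ k, codeSlice r k = R k := by
  refine ⟨{w | ∃ k v, w = codePair k v ∧ v ∈ R k}, fun k => Set.ext fun v => ?_⟩
  constructor
  · rintro ⟨k', v', h, hv⟩
    obtain ⟨rfl, rfl⟩ := codePair_inj.1 h
    exact hv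
  · exact fun h => ⟨k, v, rfl, h⟩

namespace SetArithTerm

theorem pair {f g : Γ → W} (hf : SetArithTerm S f) (hg : SetArithTerm S g) :
    SetArithTerm S fun γ => codePair (f γ) (g γ) :=
  (((hf.encode.add hg.encode).mul (hf.encode.add hg.encode)).add hf.encode).ofNat

theorem slice {r : Γ → Set W} {k : Γ → W} (hr : SetArithTerm S r) (hk : SetArithTerm S k) :
    SetArithTerm S fun γ => codeSlice (r γ) (k γ) :=
  setOf (P := fun γ v => codePair (k γ) v ∈ r γ) ((hk.weaken.pair var).mem hr.weaken)

/-- Parameters do the work here and in the next lemmas: any relation or operation on a countable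
type is coded by one set. In this way the multiplication of words and the structure of `G` enter the
formula. -/
theorem rel₁ (R : W → Prop) {f : Γ → W} (hf : SetArithTerm S f) : SetArithDef S fun γ => R (f γ) :=
  hf.mem (const {w | R w})

theorem rel₂ (R : W → W → Prop) {f g : Γ → W} (hf : SetArithTerm S f) (hg : SetArithTerm S g) :
    SetArithDef S fun γ => R (f γ) (g γ) :=
  (SetArithTerm.mem (hf.pair hg) (const {w | ∃ a b, w = codePair a b ∧ R a b})).congr fun γ => by
    simp [codePair_inj]

theorem app₁ (h : W → W) {f : Γ → W} (hf : SetArithTerm S f) : SetArithTerm S fun γ => h (f γ) :=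
  rel₂ (fun a b => a = h b) var hf.weaken

theorem app₂ (h : W → W → W) {f g : Γ → W} (hf : SetArithTerm S f) (hg : SetArithTerm S g) :
    SetArithTerm S fun γ => h (f γ) (g γ) :=
  (rel₂ (fun c p => ∃ a b, p = codePair a b ∧ c = h a b) var (hf.pair hg).weaken).congr fun q => by
    simp [codePair_inj]

end SetArithTerm

namespace SetArithFam

theorem weaken {X : Γ → Set (Set W)} (hX : SetArithFam S X) :
    SetArithFam S fun q : Γ × β => X q.1 :=
  SetArithDef.rename hX SetArithRenaming.fst.lift

theorem mem {X : Γ → Set (Set W)} (hX : SetArithFam S X) {f : Γ → Set W} (hf : SetArithTerm S f) :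
    SetArithDef S fun γ => f γ ∈ X γ :=
  SetArithDef.subst (P := fun γ p => p ∈ X γ) hX hf

theorem union {X Y : Γ → Set (Set W)} (hX : SetArithFam S X) (hY : SetArithFam S Y) :
    SetArithFam S fun γ => X γ ∪ Y γ :=
  SetArithDef.or hX hY

/-- The members of a countable family are parametrically definable. -/
theorem range (c : W → Set W) : SetArithFam S fun _ : Γ => Set.range c :=
  (SetArithDef.ex (P := fun (q : Γ × Set W) k => {v | v ∈ c k} = q.2)
    (SetArithTerm.eq (SetArithTerm.setOf (P := fun (q : (Γ × Set W) × W) v => v ∈ c q.2)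
      (SetArithTerm.rel₂ (fun k v => v ∈ c k) SetArithTerm.var.weaken SetArithTerm.var))
      SetArithTerm.var.weaken)).congr fun _ => Iff.rfl

theorem monadic : SetArithFam S fun γ : Γ => {p : Set W | code p ∈ fam (S := S) γ} :=
  ⟨_, fun _ => sat_monadic (V := Var S Γ ⊕ Unit) (Sum.inr ())⟩

end SetArithFam

/-- Every operator definable on sets is the operator of an induction formula. -/
theorem SetArithDef.exists_inductionFormula {Ψ : Set (SetArith S) → Set W → Prop}
    (h : SetArithDef S fun q : Set (SetArith S) × Set W => Ψ q.1 q.2) :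
    ∃ φ : InductionFormula setArithLang (SetArith S), ∀ A x,
      φ.Holds x A ↔ ∃ p : Set W, x = code p ∧ Ψ A p := by
  obtain ⟨φ, hφ⟩ := h
  obtain ⟨ψ, hψ⟩ := exists_mem_range_code_formula (S := S) (Set W)
    (V := SetArith S ⊕ Unit) (.inr ())
  refine ⟨(ψ.imp φ.not).not, fun A x => ?_⟩
  have hsat : ∀ χ : SetArithFormula (SetArith S ⊕ Unit),
      InductionFormula.Holds χ x A ↔ Sat χ A (Sum.elim id fun _ => x) := fun _ => Iff.rfl
  rw [hsat, sat_not, sat_imp, hψ, sat_not]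
  constructor
  · intro h
    push Not at h
    obtain ⟨⟨p, rfl⟩, h⟩ := h
    exact ⟨p, rfl, (hφ (A, p)).1 h⟩
  · rintro ⟨p, rfl, h⟩ h'
    exact h' ⟨p, rfl⟩ ((hφ (A, p)).2 h)

end Definability

/-! ### Quantifier free types over a group -/

section Types

/-- Words in two variables with coefficients in `G`. -/
abbrev TypeWord (G : Type u) : Type u := FreeGroup (G ⊕ Bool)

noncomputable instance TypeWord.instDenumerable (G : Type u) [Countable G] :
    Denumerable (TypeWord G) :=
  haveI : Countable (TypeWord G) := inferInstance
  haveI : Infinite (TypeWord G) := inferInstance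
  Classical.choice (nonempty_denumerable (TypeWord G))

namespace TypeWord

variable {G : Type u} {H : Type v} {K : Type w} [Group H] [Group K]

/-- A coefficient as a word. -/
def letter (g : G) : TypeWord G := FreeGroup.of (.inl g)

/-- One of the two variables as a word. -/
def var (i : Bool) : TypeWord G := FreeGroup.of (.inr i)

/-- Evaluation of words at two elements of a group `H` into which `G` is mapped by `j`. -/
def eval (j : G → H) (a b : H) : TypeWord G →* H :=
  FreeGroup.lift (Sum.elim j fun i => cond i a b)

@[simp]
theorem eval_letter (j : G → H) (a b : H) (g : G) : eval j a b (letter g) = j g :=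
  FreeGroup.lift_apply_of

@[simp]
theorem eval_var_true (j : G → H) (a b : H) : eval j a b (var true) = a :=
  FreeGroup.lift_apply_of

@[simp]
theorem eval_var_false (j : G → H) (a b : H) : eval j a b (var false) = b :=
  FreeGroup.lift_apply_of

theorem hom_ext {ρ ρ' : TypeWord G →* H} (h : ∀ g, ρ (letter g) = ρ' (letter g))
    (h' : ∀ i, ρ (var i) = ρ' (var i)) : ρ = ρ' :=
  FreeGroup.ext_hom _ _ (by rintro (g | i); exacts [h g, h' i])

theorem eq_eval {j : G → H} {ρ : TypeWord G →* H} (h : ∀ g, ρ (letter g) = j g) :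
    ρ = eval j (ρ (var true)) (ρ (var false)) :=
  hom_ext (fun g => by simp [h]) (by rintro (_ | _) <;> simp)

theorem map_eval (f : H →* K) (j : G → H) (a b : H) (w : TypeWord G) :
    f (eval j a b w) = eval (f ∘ j) (f a) (f b) w := by
  have : f.comp (eval j a b) = eval (f ∘ j) (f a) (f b) :=
    hom_ext (fun g => by simp) (by rintro (_ | _) <;> simp)
  exact DFunLike.congr_fun this w

/-- Substitution of words for the two variables. -/
def subst (s t : TypeWord G) : TypeWord G →* TypeWord G := eval letter s t

theorem eval_subst (j : G → H) (a b : H) (s t w : TypeWord G) :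
    eval j a b (subst s t w) = eval j (eval j a b s) (eval j a b t) w := by
  rw [subst, map_eval]
  congr 1
  congr 1
  ext g
  simp

/-- The quantifier free type over `G` of a pair of elements. -/
def pairType (j : G → H) (a b : H) : Set (TypeWord G) := {w | eval j a b w = 1}

/-- The quantifier free type over `G` of an element. -/
def elemType (j : G → H) (a : H) : Set (TypeWord G) := pairType j a 1

/-- The quantifier free types over `G` realized by pairs of elements. -/
def pairTypes (j : G → H) : Set (Set (TypeWord G)) := {p | ∃ a b, p = pairType j a b}

/-- The quantifier free type of the value of a word at the trivial elements of `G`. -/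
def constType [Group G] (w : TypeWord G) : Set (TypeWord G) := elemType id (eval id 1 1 w)

/-- Homomorphisms extending `j` are determined by their kernels. -/
def Rigid (j : G → H) : Prop :=
  ∀ ρ ρ' : TypeWord G →* H, (∀ g, ρ (letter g) = j g) → (∀ g, ρ' (letter g) = j g) →
    (∀ w, ρ w = 1 ↔ ρ' w = 1) → ρ = ρ'

theorem pairType_map {f : H →* K} (hf : Function.Injective f) (j : G → H) (a b : H) :
    pairType (f ∘ j) (f a) (f b) = pairType j a b := by
  ext w
  simp only [pairType, Set.mem_ofPred_eq, ← map_eval, map_eq_one_iff f hf]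

theorem pairTypes_subset_of_injective {f : H →* K} (hf : Function.Injective f) (j : G → H) :
    pairTypes j ⊆ pairTypes (f ∘ j) := by
  rintro p ⟨a, b, rfl⟩
  exact ⟨f a, f b, (pairType_map hf j a b).symm⟩

theorem pairTypes_congr (f : H ≃* K) (j : G → H) : pairTypes (f ∘ j) = pairTypes j := by
  refine Set.Subset.antisymm ?_ (pairTypes_subset_of_injective (f := f.toMonoidHom) f.injective j)
  have := pairTypes_subset_of_injective (f := f.symm.toMonoidHom) f.symm.injective (f ∘ j)
  convert this using 2
  ext g
  simp

/-- The types of members of `G` are the same at all levels of the tower, so they can serve as fixed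
parameters. -/
theorem elemType_map [Group G] {j : G →* H} (hj : Function.Injective j) (g : G) :
    elemType j (j g) = constType (letter g) := by
  have := pairType_map hj id g 1
  rw [map_one] at this
  rw [constType, eval_letter]
  exact this

theorem elemType_one [Group G] {j : G →* H} (hj : Function.Injective j) :
    elemType j 1 = constType 1 := by
  have := pairType_map hj id 1 1
  rwa [map_one] at this

theorem Rigid.pairType_inj {j : G → H} (hr : Rigid j) {a b a' b' : H}
    (h : pairType j a b = pairType j a' b') : a = a' ∧ b = b' := by
  have := hr (eval j a b) (eval j a' b') (by simp) (by simp) (fun w => Set.ext_iff.1 h w)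
  constructor
  · simpa using DFunLike.congr_fun this (var true)
  · simpa using DFunLike.congr_fun this (var false)

theorem Rigid.elemType_inj {j : G → H} (hr : Rigid j) {a a' : H} :
    elemType j a = elemType j a' ↔ a = a' :=
  ⟨fun h => (hr.pairType_inj h).1, fun h => by rw [h]⟩

end TypeWord

/-! ### The group interpreted in the set of its types -/

namespace TypeWord

variable {G : Type u} {H : Type v} [Group H] {j : G → H}

/-- The product of elements, in terms of the types of pairs. -/
def MulRel (X : Set (Set (TypeWord G))) (a b c : Set (TypeWord G)) : Prop :=
  ∃ p ∈ X, {w | subst (var true) 1 w ∈ p} = a ∧ {w | subst (var false) 1 w ∈ p} = b ∧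
    {w | subst (var true * var false) 1 w ∈ p} = c

/-- `a` is the type of an element. -/
def IsElem (X : Set (Set (TypeWord G))) (a : Set (TypeWord G)) : Prop :=
  ∃ b c, MulRel X a b c

/-- Pulling the type of `(g, h)` back along the substitution of a word `s` for the first variable
gives the type of the value of `s` at `(g, h)`. -/
theorem mulRel_pairTypes {a b c : Set (TypeWord G)} : MulRel (pairTypes j) a b c ↔
    ∃ g h : H, elemType j g = a ∧ elemType j h = b ∧ elemType j (g * h) = c := by
  have key : ∀ (g h : H) (s : TypeWord G),
      {w | subst s 1 w ∈ pairType j g h} = elemType j (eval j g h s) := fun g h s => by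
    ext w
    simp [pairType, elemType, eval_subst]
  constructor
  · rintro ⟨_, ⟨g, h, rfl⟩, rfl, rfl, rfl⟩
    exact ⟨g, h, by simp [key], by simp [key], by simp [key]⟩
  · rintro ⟨g, h, rfl, rfl, rfl⟩
    exact ⟨_, ⟨g, h, rfl⟩, by simp [key], by simp [key], by simp [key]⟩

theorem Rigid.mulRel_elemType (hr : Rigid j) {g h k : H} :
    MulRel (pairTypes j) (elemType j g) (elemType j h) (elemType j k) ↔ g * h = k := by
  rw [mulRel_pairTypes]
  simp only [hr.elemType_inj]
  constructor
  · rintro ⟨_, _, rfl, rfl, rfl⟩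
    rfl
  · rintro rfl
    exact ⟨g, h, rfl, rfl, rfl⟩

theorem isElem_pairTypes {a : Set (TypeWord G)} :
    IsElem (pairTypes j) a ↔ ∃ g, elemType j g = a := by
  simp only [IsElem, mulRel_pairTypes]
  constructor
  · rintro ⟨_, _, g, _, h, -, -⟩
    exact ⟨g, h⟩
  · rintro ⟨g, h⟩
    exact ⟨_, _, g, 1, h, rfl, rfl⟩

end TypeWord

/-! ### Automorphisms coded by their restrictions to `G` -/

namespace TypeWord

variable {G : Type} [Group G] [Countable G]

/-- `t` codes a homomorphism from the group of words. -/
def IsHomCode (X : Set (Set (TypeWord G))) (t : Set (TypeWord G)) : Prop :=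
  ∀ k l, MulRel X (codeSlice t k) (codeSlice t l) (codeSlice t (k * l))

/-- The element of type `a` is mapped to the element of type `b` by the automorphism whose values
on `G` are coded by `s`. -/
def GraphRel (X : Set (Set (TypeWord G))) (s a b : Set (TypeWord G)) : Prop :=
  ∃ t t', IsHomCode X t ∧ IsHomCode X t' ∧
    (∀ w, w ∈ Set.range letter → codeSlice t w = constType w ∧ codeSlice t' w = codeSlice s w) ∧
    codeSlice t (var true) = a ∧ codeSlice t' (var true) = b ∧
    ∀ w, codeSlice t w = constType 1 ↔ codeSlice t' w = constType 1

/-- `s` codes the restriction of an automorphism to `G`. -/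
def IsAutCode (X : Set (Set (TypeWord G))) (s : Set (TypeWord G)) : Prop :=
  (∀ a, IsElem X a → ∃ b, GraphRel X s a b) ∧ (∀ b, IsElem X b → ∃ a, GraphRel X s a b) ∧
  (∀ a b b', GraphRel X s a b → GraphRel X s a b' → b = b') ∧
  (∀ a a' b, GraphRel X s a b → GraphRel X s a' b → a = a') ∧
  ∀ a b c a' b' c', GraphRel X s a a' → GraphRel X s b b' → MulRel X a b c → MulRel X a' b' c' →
    GraphRel X s c c'

/-- The types of pairs of automorphisms, in terms of the types of pairs of elements. -/
def autTypes (X : Set (Set (TypeWord G))) : Set (Set (TypeWord G)) :=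
  {p | ∃ r, (∀ w, IsAutCode X (codeSlice r w)) ∧
    (∀ w w' a b c, GraphRel X (codeSlice r w') a b → GraphRel X (codeSlice r w) b c →
      GraphRel X (codeSlice r (w * w')) a c) ∧
    (∀ w, w ∈ Set.range letter → ∀ a b c, MulRel X (constType w) a c → MulRel X b (constType w) c →
      GraphRel X (codeSlice r w) a b) ∧
    ∀ w, w ∈ p ↔ ∀ a, IsElem X a → GraphRel X (codeSlice r w) a a}

section Semantics

variable {H : Type v} [Group H] {j : G →* H}

theorem Rigid.isHomCode_pairTypes (hr : Rigid j) {t : Set (TypeWord G)} :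
    IsHomCode (pairTypes j) t ↔ ∃ ρ : TypeWord G →* H, ∀ k, codeSlice t k = elemType j (ρ k) := by
  constructor
  · intro h
    have : ∀ k, ∃ g, elemType j g = codeSlice t k := fun k =>
      isElem_pairTypes.1 ⟨_, _, h k 1⟩
    choose ρ hρ using this
    refine ⟨MonoidHom.mk' ρ fun k l => ?_, fun k => (hρ k).symm⟩
    have := h k l
    rw [← hρ, ← hρ, ← hρ, hr.mulRel_elemType] at this
    exact this.symm
  · rintro ⟨ρ, hρ⟩ k l
    rw [hρ, hρ, hρ, hr.mulRel_elemType, map_mul]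

theorem Rigid.graphRel_pairTypes (hr : Rigid j) (hj : Function.Injective j)
    {s a b : Set (TypeWord G)} : GraphRel (pairTypes j) s a b ↔
    ∃ ρ ρ' : TypeWord G →* H, (∀ g, ρ (letter g) = j g) ∧
      (∀ g, elemType j (ρ' (letter g)) = codeSlice s (letter g)) ∧
      elemType j (ρ (var true)) = a ∧ elemType j (ρ' (var true)) = b ∧
      ∀ w, ρ w = 1 ↔ ρ' w = 1 := by
  constructor
  · rintro ⟨t, t', ht, ht', hl, ha, hb, hk⟩
    obtain ⟨ρ, hρ⟩ := hr.isHomCode_pairTypes.1 ht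
    obtain ⟨ρ', hρ'⟩ := hr.isHomCode_pairTypes.1 ht'
    refine ⟨ρ, ρ', fun g => ?_, fun g => ?_, ?_, ?_, fun w => ?_⟩
    · rw [← hr.elemType_inj, ← hρ, elemType_map hj]
      exact (hl _ ⟨g, rfl⟩).1
    · rw [← hρ']
      exact (hl _ ⟨g, rfl⟩).2
    · rw [← hρ, ha]
    · rw [← hρ', hb]
    · rw [← hr.elemType_inj, ← hr.elemType_inj (a := ρ' w), ← hρ, ← hρ', elemType_one hj]
      exact hk w
  · rintro ⟨ρ, ρ', hρ, hρ', rfl, rfl, hk⟩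
    obtain ⟨t, ht⟩ := exists_codeSlice_eq fun w => elemType j (ρ w)
    obtain ⟨t', ht'⟩ := exists_codeSlice_eq fun w => elemType j (ρ' w)
    refine ⟨t, t', hr.isHomCode_pairTypes.2 ⟨ρ, ht⟩, hr.isHomCode_pairTypes.2 ⟨ρ', ht'⟩, ?_,
      ht _, ht' _, fun w => ?_⟩
    · rintro _ ⟨g, rfl⟩
      rw [ht, ht', hρ, hρ', elemType_map hj]
      exact ⟨rfl, rfl⟩
    · rw [ht, ht', ← elemType_one hj, hr.elemType_inj, hr.elemType_inj, hk]

/-- If `ρ` extends `j`, `ρ'` extends `σ ∘ j` and their kernels agree, then `ρ` and `σ⁻¹ ∘ ρ'` both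
extend `j` with equal kernels. Rigidity makes them equal, so `σ` sends the value of `ρ` at the
variable to that of `ρ'`. -/
theorem Rigid.graphRel_of_aut (hr : Rigid j) (hj : Function.Injective j) {s : Set (TypeWord G)}
    {σ : MulAut H} (hs : ∀ g, codeSlice s (letter g) = elemType j (σ (j g)))
    {a b : Set (TypeWord G)} : GraphRel (pairTypes j) s a b ↔
      ∃ g, elemType j g = a ∧ elemType j (σ g) = b := by
  rw [hr.graphRel_pairTypes hj]
  constructor
  · rintro ⟨ρ, ρ', hρ, hρ', rfl, rfl, hk⟩
    refine ⟨_, rfl, ?_⟩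
    have : ρ = (σ⁻¹ : MulAut H).toMonoidHom.comp ρ' := by
      refine hr _ _ hρ (fun g => ?_) fun w => ?_
      · have := hρ' g
        rw [hs, hr.elemType_inj] at this
        simp [this]
      · rw [hk]
        simp
    rw [this]
    simp
  · rintro ⟨g, rfl, rfl⟩
    refine ⟨eval j g 1, σ.toMonoidHom.comp (eval j g 1), by simp, ?_, by simp, by simp, by simp⟩
    intro k
    simp [hs]

theorem Rigid.exists_aut_of_isAutCode (hr : Rigid j) (hj : Function.Injective j)
    {s : Set (TypeWord G)} (hs : IsAutCode (pairTypes j) s) : ∃ σ : MulAut H,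
      ∀ g h, GraphRel (pairTypes j) s (elemType j g) (elemType j h) ↔ σ g = h := by
  obtain ⟨h₁, h₂, h₃, h₄, h₅⟩ := hs
  have right : ∀ {a b}, GraphRel (pairTypes j) s a b → ∃ h, elemType j h = b := fun hab => by
    obtain ⟨_, ρ', -, -, -, h, -⟩ := (hr.graphRel_pairTypes hj).1 hab
    exact ⟨_, h⟩
  have left : ∀ {a b}, GraphRel (pairTypes j) s a b → ∃ h, elemType j h = a := fun hab => by
    obtain ⟨ρ, _, -, -, h, -, -⟩ := (hr.graphRel_pairTypes hj).1 hab
    exact ⟨_, h⟩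
  have total : ∀ g, ∃ h, GraphRel (pairTypes j) s (elemType j g) (elemType j h) := fun g => by
    obtain ⟨b, hb⟩ := h₁ _ (isElem_pairTypes.2 ⟨g, rfl⟩)
    obtain ⟨h, rfl⟩ := right hb
    exact ⟨h, hb⟩
  choose f hf using total
  have hfun : ∀ g h, GraphRel (pairTypes j) s (elemType j g) (elemType j h) ↔ f g = h := by
    intro g h
    refine ⟨fun hgh => hr.elemType_inj.1 (h₃ _ _ _ (hf g) hgh), ?_⟩
    rintro rfl
    exact hf g
  have hmul : ∀ g h, f (g * h) = f g * f h := fun g h => (hfun _ _).1 <|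
    h₅ _ _ _ _ _ _ (hf g) (hf h) (hr.mulRel_elemType.2 rfl) (hr.mulRel_elemType.2 rfl)
  have hbij : Function.Bijective (MonoidHom.mk' f hmul) := by
    constructor
    · intro g h hgh
      refine hr.elemType_inj.1 (h₄ _ _ _ (hf g) ?_)
      rw [hfun]
      exact hgh.symm
    · intro h
      obtain ⟨a, ha⟩ := h₂ _ (isElem_pairTypes.2 ⟨h, rfl⟩)
      obtain ⟨g, rfl⟩ := left ha
      exact ⟨g, (hfun _ _).1 ha⟩
  exact ⟨MulEquiv.ofBijective _ hbij, hfun⟩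

theorem Rigid.isAutCode_of_aut (hr : Rigid j) (hj : Function.Injective j)
    {s : Set (TypeWord G)} {σ : MulAut H}
    (hs : ∀ g, codeSlice s (letter g) = elemType j (σ (j g))) : IsAutCode (pairTypes j) s := by
  simp only [IsAutCode, hr.graphRel_of_aut hj hs, isElem_pairTypes]
  refine ⟨?_, ?_, ?_, ?_, ?_⟩
  · rintro _ ⟨g, rfl⟩
    exact ⟨_, g, rfl, rfl⟩
  · rintro _ ⟨g, rfl⟩
    exact ⟨_, σ⁻¹ g, rfl, by simp⟩
  · rintro _ _ _ ⟨g, rfl, rfl⟩ ⟨h, hh, rfl⟩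
    rw [hr.elemType_inj.1 hh]
  · rintro _ _ _ ⟨g, rfl, rfl⟩ ⟨h, rfl, hh⟩
    rw [σ.injective (hr.elemType_inj.1 hh)]
  · rintro _ _ c _ _ c' ⟨g, rfl, rfl⟩ ⟨h, rfl, rfl⟩ hc hc'
    obtain ⟨k, rfl⟩ : ∃ k, elemType j k = c := by
      obtain ⟨_, _, -, -, h⟩ := mulRel_pairTypes.1 hc
      exact ⟨_, h⟩
    obtain ⟨k', rfl⟩ : ∃ k, elemType j k = c' := by
      obtain ⟨_, _, -, -, h⟩ := mulRel_pairTypes.1 hc'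
      exact ⟨_, h⟩
    rw [hr.mulRel_elemType] at hc hc'
    exact ⟨_, rfl, by rw [← hc, ← hc', map_mul]⟩

/-- The types of pairs of automorphisms are determined by the types of pairs of elements. -/
theorem Rigid.autTypes_pairTypes (hr : Rigid j) (hj : Function.Injective j) :
    autTypes (pairTypes j) = pairTypes (MulAut.conj.comp j) := by
  ext p
  constructor
  · rintro ⟨r, haut, hmul, hconj, hp⟩
    choose σ hσ using fun w => hr.exists_aut_of_isAutCode hj (haut w)
    let ρ : TypeWord G →* MulAut H := MonoidHom.mk' σ fun w w' => by
      ext g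
      exact (hσ _ _ _).1 (hmul w w' _ _ _ ((hσ w' _ _).2 rfl) ((hσ w _ _).2 rfl))
    have hρ : ∀ g, ρ (letter g) = (MulAut.conj.comp j) g := fun g => by
      ext h
      refine (hσ _ _ _).1 (hconj _ ⟨g, rfl⟩ _ _ (elemType j (j g * h)) ?_ ?_)
      · rw [← elemType_map hj, hr.mulRel_elemType]
      · rw [← elemType_map hj, hr.mulRel_elemType]
        simp
    refine ⟨ρ (var true), ρ (var false), ?_⟩
    ext w
    -- `ρ` extends the embedding of `G` by inner automorphisms, so it is evaluation at its own
    -- values on the two variables, and `p` is its kernel.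
    rw [pairType, ← eq_eval hρ, hp]
    simp only [isElem_pairTypes]
    constructor
    · intro h
      ext g
      exact (hσ _ _ _).1 (h _ ⟨g, rfl⟩)
    · rintro h _ ⟨g, rfl⟩
      rw [hσ]
      exact DFunLike.congr_fun h g
  · rintro ⟨α, β, rfl⟩
    set ρ := eval (MulAut.conj.comp j) α β with hρ
    -- Only the slices at letters matter; putting `1` for the variables merely makes the sequence
    -- total.
    have : ∀ w, ∃ s, ∀ k, codeSlice s k = elemType j (ρ w (eval j 1 1 k)) := fun w =>
      exists_codeSlice_eq _
    choose R hR using this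
    obtain ⟨r, hr'⟩ := exists_codeSlice_eq R
    have hs : ∀ w g, codeSlice (codeSlice r w) (letter g) = elemType j (ρ w (j g)) :=
      fun w g => by rw [hr', hR, eval_letter]
    have hG := fun w {a b} => hr.graphRel_of_aut hj (hs w) (a := a) (b := b)
    refine ⟨r, fun w => hr.isAutCode_of_aut hj (hs w), ?_, ?_, ?_⟩
    · intro w w' a b c
      simp only [hG]
      rintro ⟨g, rfl, rfl⟩ ⟨h, hh, rfl⟩
      rw [hr.elemType_inj] at hh
      exact ⟨g, rfl, by rw [map_mul, hh]; rfl⟩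
    · rintro _ ⟨g, rfl⟩ a b c hac hbc
      rw [← elemType_map hj, mulRel_pairTypes] at hac hbc
      obtain ⟨g₁, h, hg₁, rfl, rfl⟩ := hac
      obtain ⟨k, g₂, rfl, hg₂, hk⟩ := hbc
      rw [hr.elemType_inj] at hg₁ hg₂ hk
      subst hg₁ hg₂
      refine (hG _).2 ⟨h, rfl, ?_⟩
      rw [hρ, eval_letter, hr.elemType_inj]
      simp [← hk]
    · intro w
      simp only [hG, isElem_pairTypes]
      constructor
      · rintro hw _ ⟨g, rfl⟩
        exact ⟨g, rfl, by rw [show ρ w = 1 from hw]; rfl⟩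
      · intro h
        change ρ w = 1
        ext g
        obtain ⟨g', hg', h'⟩ := h _ ⟨g, rfl⟩
        rw [hr.elemType_inj] at hg' h'
        rw [← hg', h', hg']
        rfl

end Semantics

end TypeWord

end Types

/-! ### Definability of the successor step of the tower -/

section AutTypesDefinable

namespace TypeWord

variable {S : Set ℕ} [Group S] {Γ : Type} [SetArithCtx S Γ] {X : Γ → Set (Set (TypeWord S))}
  {s a b c : Γ → Set (TypeWord S)}

/-- The proofs of this section follow the definitions clause by clause. The number of `weaken`s
after `SetArithTerm.var` is a de Bruijn index, counted from the innermost bound variable. -/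
theorem setArithDef_mulRel (hX : SetArithFam S X) (ha : SetArithTerm S a) (hb : SetArithTerm S b)
    (hc : SetArithTerm S c) : SetArithDef S fun γ => MulRel (X γ) (a γ) (b γ) (c γ) := by
  have key : ∀ (f : TypeWord S → TypeWord S), SetArithTerm S
      fun q : Γ × Set (TypeWord S) => {w | f w ∈ q.2} := fun f =>
    SetArithTerm.setOf (P := fun (q : Γ × Set (TypeWord S)) w => f w ∈ q.2)
      ((SetArithTerm.var.app₁ f).mem SetArithTerm.var.weaken)
  exact SetArithDef.ex <| (hX.weaken.mem .var).and <| ((key _).eq ha.weaken).and <|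
    ((key _).eq hb.weaken).and ((key _).eq hc.weaken)

theorem setArithDef_isElem (hX : SetArithFam S X) (ha : SetArithTerm S a) :
    SetArithDef S fun γ => IsElem (X γ) (a γ) :=
  SetArithDef.ex <| SetArithDef.ex <|
    setArithDef_mulRel hX.weaken.weaken ha.weaken.weaken SetArithTerm.var.weaken .var

theorem setArithDef_isHomCode (hX : SetArithFam S X) (ha : SetArithTerm S a) :
    SetArithDef S fun γ => IsHomCode (X γ) (a γ) :=
  SetArithDef.all <| SetArithDef.all <| setArithDef_mulRel hX.weaken.weaken
    (ha.weaken.weaken.slice SetArithTerm.var.weaken) (ha.weaken.weaken.slice .var)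
    (ha.weaken.weaken.slice (.app₂ (· * ·) SetArithTerm.var.weaken .var))

theorem setArithTerm_constType {k : Γ → TypeWord S} (hk : SetArithTerm S k) :
    SetArithTerm S fun γ => constType (k γ) :=
  SetArithTerm.setOf (P := fun γ w => w ∈ constType (k γ))
    (SetArithTerm.rel₂ (fun k w => w ∈ constType k) hk.weaken .var)

theorem setArithDef_graphRel (hX : SetArithFam S X) (hs : SetArithTerm S s)
    (ha : SetArithTerm S a) (hb : SetArithTerm S b) :
    SetArithDef S fun γ => GraphRel (X γ) (s γ) (a γ) (b γ) := by
  refine SetArithDef.ex <| SetArithDef.ex <|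
    (setArithDef_isHomCode hX.weaken.weaken SetArithTerm.var.weaken).and <|
    (setArithDef_isHomCode hX.weaken.weaken .var).and <|
    (SetArithDef.all <| (SetArithTerm.rel₁ (· ∈ Set.range letter) .var).imp <|
      SetArithDef.and ?_ ?_).and <|
    ((SetArithTerm.var.weaken.slice (.const _)).eq ha.weaken.weaken).and <|
    ((SetArithTerm.var.slice (.const _)).eq hb.weaken.weaken).and <|
    SetArithDef.all <| SetArithDef.iff ?_ ?_
  · exact (SetArithTerm.var.weaken.weaken.slice .var).eq (setArithTerm_constType .var)
  · exact (SetArithTerm.var.weaken.slice .var).eq (hs.weaken.weaken.weaken.slice .var)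
  · exact (SetArithTerm.var.weaken.weaken.slice .var).eq (.const _)
  · exact (SetArithTerm.var.weaken.slice .var).eq (.const _)

theorem setArithDef_isAutCode (hX : SetArithFam S X) (hs : SetArithTerm S s) :
    SetArithDef S fun γ => IsAutCode (X γ) (s γ) := by
  refine .and ?_ <| .and ?_ <| .and ?_ <| .and ?_ ?_
  · exact .all <| (setArithDef_isElem hX.weaken .var).imp <| .ex <|
      setArithDef_graphRel hX.weaken.weaken hs.weaken.weaken SetArithTerm.var.weaken .var
  · exact .all <| (setArithDef_isElem hX.weaken .var).imp <| .ex <|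
      setArithDef_graphRel hX.weaken.weaken hs.weaken.weaken .var SetArithTerm.var.weaken
  · exact .all <| .all <| .all <| .imp
      (setArithDef_graphRel hX.weaken.weaken.weaken hs.weaken.weaken.weaken
        SetArithTerm.var.weaken.weaken SetArithTerm.var.weaken) <| .imp
      (setArithDef_graphRel hX.weaken.weaken.weaken hs.weaken.weaken.weaken
        SetArithTerm.var.weaken.weaken .var) <|
      SetArithTerm.var.weaken.eq .var
  · exact .all <| .all <| .all <| .imp
      (setArithDef_graphRel hX.weaken.weaken.weaken hs.weaken.weaken.weaken
        SetArithTerm.var.weaken.weaken .var) <| .imp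
      (setArithDef_graphRel hX.weaken.weaken.weaken hs.weaken.weaken.weaken
        SetArithTerm.var.weaken .var) <|
      SetArithTerm.var.weaken.weaken.eq SetArithTerm.var.weaken
  · have hX' := hX.weaken (β := Set (TypeWord S)) |>.weaken (β := Set (TypeWord S))
      |>.weaken (β := Set (TypeWord S)) |>.weaken (β := Set (TypeWord S))
      |>.weaken (β := Set (TypeWord S)) |>.weaken (β := Set (TypeWord S))
    have hs' := hs.weaken (β' := Set (TypeWord S)) |>.weaken (β' := Set (TypeWord S))
      |>.weaken (β' := Set (TypeWord S)) |>.weaken (β' := Set (TypeWord S))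
      |>.weaken (β' := Set (TypeWord S)) |>.weaken (β' := Set (TypeWord S))
    exact .all <| .all <| .all <| .all <| .all <| .all <| .imp
      (setArithDef_graphRel hX' hs' SetArithTerm.var.weaken.weaken.weaken.weaken.weaken
        SetArithTerm.var.weaken.weaken) <| .imp
      (setArithDef_graphRel hX' hs' SetArithTerm.var.weaken.weaken.weaken.weaken
        SetArithTerm.var.weaken) <| .imp
      (setArithDef_mulRel hX' SetArithTerm.var.weaken.weaken.weaken.weaken.weaken
        SetArithTerm.var.weaken.weaken.weaken.weaken SetArithTerm.var.weaken.weaken.weaken) <| .imp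
      (setArithDef_mulRel hX' SetArithTerm.var.weaken.weaken SetArithTerm.var.weaken .var) <|
      setArithDef_graphRel hX' hs' SetArithTerm.var.weaken.weaken.weaken .var

theorem setArithFam_autTypes (hX : SetArithFam S X) : SetArithFam S fun γ => autTypes (X γ) := by
  refine .ex <| .and ?_ <| .and ?_ <| .and ?_ ?_
  · exact .all <| setArithDef_isAutCode hX.weaken.weaken.weaken (SetArithTerm.var.weaken.slice .var)
  · have hX' := hX.weaken (β := Set (TypeWord S)) |>.weaken (β := Set (TypeWord S))
      |>.weaken (β := TypeWord S) |>.weaken (β := TypeWord S)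
      |>.weaken (β := Set (TypeWord S)) |>.weaken (β := Set (TypeWord S))
      |>.weaken (β := Set (TypeWord S))
    exact .all <| .all <| .all <| .all <| .all <| .imp
      (setArithDef_graphRel hX' (SetArithTerm.var.weaken.weaken.weaken.weaken.weaken.slice
        SetArithTerm.var.weaken.weaken.weaken) SetArithTerm.var.weaken.weaken
        SetArithTerm.var.weaken) <| .imp
      (setArithDef_graphRel hX' (SetArithTerm.var.weaken.weaken.weaken.weaken.weaken.slice
        SetArithTerm.var.weaken.weaken.weaken.weaken) SetArithTerm.var.weaken .var) <|
      setArithDef_graphRel hX' (SetArithTerm.var.weaken.weaken.weaken.weaken.weaken.slice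
        (.app₂ (· * ·) SetArithTerm.var.weaken.weaken.weaken.weaken
          SetArithTerm.var.weaken.weaken.weaken)) SetArithTerm.var.weaken.weaken .var
  · have hX' := hX.weaken (β := Set (TypeWord S)) |>.weaken (β := Set (TypeWord S))
      |>.weaken (β := TypeWord S)
      |>.weaken (β := Set (TypeWord S)) |>.weaken (β := Set (TypeWord S))
      |>.weaken (β := Set (TypeWord S))
    exact .all <| (SetArithTerm.rel₁ (· ∈ Set.range letter) .var).imp <|
      .all <| .all <| .all <| .imp
      (setArithDef_mulRel hX' (setArithTerm_constType SetArithTerm.var.weaken.weaken.weaken)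
        SetArithTerm.var.weaken.weaken .var) <| .imp
      (setArithDef_mulRel hX' SetArithTerm.var.weaken
        (setArithTerm_constType SetArithTerm.var.weaken.weaken.weaken) .var) <|
      setArithDef_graphRel hX' (SetArithTerm.var.weaken.weaken.weaken.weaken.slice
        SetArithTerm.var.weaken.weaken.weaken) SetArithTerm.var.weaken.weaken
        SetArithTerm.var.weaken
  · exact .all <| .iff (SetArithTerm.var.mem SetArithTerm.var.weaken.weaken) <| .all <|
      (setArithDef_isElem hX.weaken.weaken.weaken.weaken .var).imp <|
      setArithDef_graphRel hX.weaken.weaken.weaken.weaken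
        (SetArithTerm.var.weaken.weaken.slice SetArithTerm.var.weaken) .var .var

end TypeWord

end AutTypesDefinable

/-! ### The types realized in the groups of the tower -/

section TowerTypes

open TypeWord

namespace autTower

theorem rigid_base {G : Type u} [Group G] (hG : Subgroup.center G = ⊥) (γ : Ordinal.{u}) :
    Rigid (base G γ) := fun _ _ h h' hk =>
  hom_ext_of_ker_le (trans_injective_and_centralizer hG γ).2 (fun w => (hk w).1) h h'

/-- The quantifier free types over `G` of the pairs of elements of `G^α`. -/
def types (G : Type u) [Group G] (α : Ordinal.{u}) : Set (Set (TypeWord G)) :=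
  pairTypes (base G α)

section

variable {G : Type u} [Group G]

theorem types_mono (hG : Subgroup.center G = ⊥) : Monotone (types G) := fun α β h => by
  have := pairTypes_subset_of_injective (trans_injective hG h) (base G α)
  rwa [show trans G h ∘ base G α = base G β from funext (trans_base G h)] at this

theorem types_zero : types G 0 = pairTypes (id : G → G) := by
  rw [← pairTypes_congr (botEquiv G)]
  exact congrArg pairTypes (funext fun g => trans_refl G 0 (botEquiv G g))

theorem types_zero_nonempty : (types G 0).Nonempty :=
  ⟨_, 1, 1, rfl⟩

theorem exists_range_eq_types_zero (G : Type u) [Group G] [Countable G] :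
    ∃ c : TypeWord G → Set (TypeWord G), Set.range c = types G 0 := by
  have hc : (types G 0).Countable := by
    rw [types_zero]
    refine (Set.countable_range fun q : G × G => pairType id q.1 q.2).mono ?_
    rintro _ ⟨a, b, rfl⟩
    exact ⟨(a, b), rfl⟩
  obtain ⟨f, hf⟩ := hc.exists_eq_range types_zero_nonempty
  exact ⟨f ∘ Denumerable.eqv (TypeWord G), by rw [(Equiv.surjective _).range_comp, hf]⟩

theorem types_limit (hG : Subgroup.center G = ⊥) {δ : Ordinal.{u}} (hδ : Order.IsSuccLimit δ)
    {p : Set (TypeWord G)} (hp : p ∈ types G δ) : ∃ β < δ, p ∈ types G β := by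
  obtain ⟨a, b, rfl⟩ := hp
  obtain ⟨β, hβ, a, rfl⟩ := exists_trans_eq_of_isSuccLimit G hδ a
  obtain ⟨γ, hγ, b, rfl⟩ := exists_trans_eq_of_isSuccLimit G hδ b
  refine ⟨max β γ, max_lt hβ hγ, trans G (le_max_left ..) a, trans G (le_max_right ..) b, ?_⟩
  rw [← pairType_map (trans_injective hG (max_lt hβ hγ).le), trans_trans, trans_trans]
  exact congrArg (fun j => pairType j _ _) (funext fun g => (trans_base ..).symm)

/-- The type of any `z` in `G^(α+1)` is already realized by some `a` in `G^α`; rigidity in `G^(α+1)`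
identifies `z` with the image of `a`. -/
theorem stopsAt_of_types_eq (hG : Subgroup.center G = ⊥) {α : Ordinal.{u}}
    (h : types G α = types G (Order.succ α)) : AutTowerStopsAt G α := by
  refine ⟨trans_injective hG (Order.le_succ α), fun z => ?_⟩
  have hz : pairType (base G (Order.succ α)) z 1 ∈ types G α := h ▸ ⟨z, 1, rfl⟩
  obtain ⟨a, b, hab⟩ := hz
  rw [← pairType_map (trans_injective hG (Order.le_succ α)),
    show trans G (Order.le_succ α) ∘ base G α = base G (Order.succ α) from
      funext (trans_base G _)] at hab
  exact ⟨a, ((rigid_base hG _).pairType_inj hab).1.symm⟩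

/-- Otherwise the ordinals would inject into the sets of types. A nonzero `α` is wanted because the
induction starts from `∅` and not from `types G 0`. -/
theorem exists_types_eq (hG : Subgroup.center G = ⊥) :
    ∃ α ≠ 0, types G α = types G (Order.succ α) := by
  by_contra! h
  have : StrictMono fun α => types G (Order.succ α) := fun α β hαβ =>
    ((types_mono hG (Order.le_succ (Order.succ α))).lt_of_ne
      (h _ (Order.bot_lt_succ α).ne')).trans_le
      (types_mono hG (Order.succ_le_succ (Order.succ_le_of_lt hαβ)))
  exact not_injective_of_ordinal _ this.injective

end

/-- The isomorphism of `G^(α+1)` with `Aut (G^α)` turns the embedding of `G` into conjugation by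
members of `G`. -/
theorem types_succ {G : Type} [Group G] [Countable G] (hG : Subgroup.center G = ⊥)
    (α : Ordinal.{0}) : types G (Order.succ α) = autTypes (types G α) := by
  rw [types, types, (rigid_base hG α).autTypes_pairTypes (base_injective hG α),
    ← pairTypes_congr (succEquiv G α)]
  refine congrArg pairTypes (funext fun g => ?_)
  rw [Function.comp_apply, ← trans_base G (Order.le_succ α), succEquiv_trans]
  rfl

end autTower

end TowerTypes

/-! ### Stages of inductions -/

section Stages

namespace InductionFormula

variable {L : FirstOrder.Language.{0, 0}} {M : Type w} [L.Structure M]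
  (φ : InductionFormula L M)

theorem stage_zero : φ.stage 0 = ∅ := Ordinal.limitRecOn_zero ..

theorem stage_succ (α : Ordinal.{w}) :
    φ.stage (Order.succ α) = φ.stage α ∪ {x | φ.Holds x (φ.stage α)} :=
  Ordinal.limitRecOn_add_one ..

theorem mem_stage_limit {δ : Ordinal.{w}} (hδ : Order.IsSuccLimit δ) {x : M} :
    x ∈ φ.stage δ ↔ ∃ β < δ, x ∈ φ.stage β := by
  rw [stage, Ordinal.limitRecOn_limit _ _ _ _ hδ]
  simp [stage]

/-- The formulas form a small type, so their closure ordinals are bounded and the infimum is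
attained. -/
theorem closureOrdinal_lt_inductiveOrdinal : φ.closureOrdinal < inductiveOrdinal L M := by
  obtain ⟨b, hb⟩ := Ordinal.bddAbove_of_small (s := Set.range
    (InductionFormula.closureOrdinal : InductionFormula L M → Ordinal.{w}))
  exact csInf_mem (s := {δ | ∀ φ : InductionFormula L M, φ.closureOrdinal < δ})
    ⟨Order.succ b, fun ψ => Order.lt_succ_of_le (hb ⟨ψ, rfl⟩)⟩ φ

end InductionFormula

end Stages

/-! ### The induction that follows the tower, and the main theorem -/

section Main

open TypeWord autTower SetArithCoded

variable {S : Set ℕ} [Group S]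

/-- There is an induction whose stages are the sets of types realized in the groups of the tower. -/
theorem exists_stage_eq_types (hS : Subgroup.center S = ⊥) :
    ∃ φ : InductionFormula setArithLang (SetArith S),
      ∀ α : Ordinal.{0}, α ≠ 0 → φ.stage α = code '' types S α := by
  -- Adding `types S 0` replaces the empty stage by the types of the bottom group. At later stages
  -- it adds nothing, since the types increase.
  have hX : SetArithFam S fun A : Set (SetArith S) =>
      autTypes ({p : Set (TypeWord S) | code p ∈ A} ∪ types S 0) := by
    obtain ⟨c, hc⟩ := exists_range_eq_types_zero S
    rw [← hc]
    exact setArithFam_autTypes (SetArithFam.monadic.union (.range c))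
  obtain ⟨φ, hφ⟩ := SetArithDef.exists_inductionFormula
    (Ψ := fun A p => p ∈ autTypes ({p : Set (TypeWord S) | code p ∈ A} ∪ types S 0)) hX
  have step : ∀ α : Ordinal.{0}, (α ≠ 0 → φ.stage α = code '' types S α) →
      φ.stage (Order.succ α) = code '' types S (Order.succ α) := by
    intro α hα
    have hfam : {p : Set (TypeWord S) | code p ∈ φ.stage α} ∪ types S 0 = types S α := by
      rcases eq_or_ne α 0 with rfl | h0
      · simp [φ.stage_zero]
      · rw [hα h0]
        ext p
        simp only [Set.mem_union, Set.mem_ofPred_eq, code_injective.mem_set_image]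
        exact or_iff_left_of_imp fun h => types_mono hS zero_le h
    have hsub : φ.stage α ⊆ code '' types S (Order.succ α) := by
      rcases eq_or_ne α 0 with rfl | h0
      · simp [φ.stage_zero]
      · rw [hα h0]
        exact Set.image_mono (types_mono hS (Order.le_succ α))
    have hnew : {x | φ.Holds x (φ.stage α)} = code '' types S (Order.succ α) := by
      ext x
      rw [Set.mem_ofPred_eq, hφ, hfam, ← types_succ hS]
      constructor
      · rintro ⟨p, rfl, hp⟩
        exact ⟨p, hp, rfl⟩
      · rintro ⟨p, hp, rfl⟩
        exact ⟨p, rfl, hp⟩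
    rw [φ.stage_succ, hnew, Set.union_eq_right.2 hsub]
  refine ⟨φ, fun α => ?_⟩
  induction α using Ordinal.limitRecOn with
  | zero => exact fun h => absurd rfl h
  | add_one α ih => exact fun _ => step α ih
  | limit δ hδ ih =>
    intro _
    ext x
    rw [φ.mem_stage_limit hδ]
    constructor
    · rintro ⟨β, hβ, hx⟩
      rcases eq_or_ne β 0 with rfl | h0
      · simp [φ.stage_zero] at hx
      · rw [ih β hβ h0] at hx
        exact Set.image_mono (types_mono hS hβ.le) hx
    · rintro ⟨p, hp, rfl⟩
      obtain ⟨β, hβ, hp⟩ := types_limit hS hδ hp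
      -- `β` may be `0`, where the stage is empty, so the successor is used instead.
      have hβ' := hδ.succ_lt hβ
      refine ⟨Order.succ β, hβ', ?_⟩
      rw [ih _ hβ' (Order.bot_lt_succ β).ne']
      exact ⟨p, types_mono hS (Order.le_succ β) hp, rfl⟩

end Main

theorem mainTheorem8 (S : Set ℕ) [Group S] (hS : Subgroup.center S = ⊥) :
    (∃ α : Ordinal.{0}, AutTowerStopsAt S α) ∧
      autTowerHeight S < inductiveOrdinal setArithLang (SetArith S) := by
  obtain ⟨φ, hφ⟩ := exists_stage_eq_types hS
  obtain ⟨α, hα, h⟩ := autTower.exists_types_eq hS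
  refine ⟨⟨α, autTower.stopsAt_of_types_eq hS h⟩,
    lt_of_le_of_lt (csInf_le' ?_) φ.closureOrdinal_lt_inductiveOrdinal⟩
  -- An infimum over the empty set would be `0`; the stabilization of the types shows that the
  -- induction does close.
  have hmem : φ.closureOrdinal ∈ {α | φ.stage α = φ.stage (α + 1)} :=
    csInf_mem ⟨α, by
      rw [Set.mem_ofPred_eq, hφ α hα, h]
      exact (hφ _ (Order.bot_lt_succ α).ne').symm⟩
  have hsucc := hφ (φ.closureOrdinal + 1) (Order.bot_lt_succ φ.closureOrdinal).ne'
  -- Stage `0` is empty while stage `1` is not, so the induction cannot close at `0`, where stages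
  -- and types differ.
  have h0 : φ.closureOrdinal ≠ 0 := fun h0 => by
    rw [Set.mem_ofPred_eq, hsucc, h0, φ.stage_zero] at hmem
    obtain ⟨p, hp⟩ := autTower.types_zero_nonempty (G := S)
    exact (Set.image_nonempty.2 ⟨p, autTower.types_mono hS zero_le hp⟩).ne_empty hmem.symm
  rw [Set.mem_ofPred_eq, hsucc, hφ _ h0] at hmem
  exact autTower.stopsAt_of_types_eq hS (SetArithCoded.code_injective.image_injective hmem)
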